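/- For $n\ge 1$ let $B_n$ be the braid group with generators $\sigma_1,\dots,\sigma_{n-1}$ and relations $\sigma_i\sigma_{i+1}\sigma_i=\sigma_{i+1}\sigma_i\sigma_{i+1}$ for $1\le i\le n-2$ and $\sigma_i\sigma_j=\sigma_j\sigma_i$ for $|i-j|>1$, and for $n \geq 2$ regard $B_{n-1}$ as the subgroup of $B_n$ generated by $\sigma_1,\dots,\sigma_{n-2}$, via $\sigma_i\mapsto\sigma_i$. For $1\le i<j\le n$ let $$A_{i,j}=\sigma_{j-1}\cdots\sigma_{i+1}\,\sigma_i^2\,\sigma_{i+1}^{-1}\cdots\sigma_{j-1}^{-1}\in B_n .$$ Let $F_n$ be the free group on $x_1,\dots,x_n$, on which $B_n$ acts from the right by automorphisms (the Artin action, $x^{\beta\gamma}=(x^\beta)^\gamma$), where $x_i^{\sigma_i}=x_ix_{i+1}x_i^{-1}$, $x_{i+1}^{\sigma_i}=x_i$, and $x_j^{\sigma_i}=x_j$ for $j\ne i,i+1$. A bi-ordering of a group $G$ is a strict total ordering $<$ of $G$ such that $f<g$ implies $hf<hg$ and $fh<gh$ for all $f,g,h\in G$. A braid $\beta\in B_n$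 is called order-preserving if there is a bi-ordering $<$ of $F_n$ such that, for all $f,g\in F_n$, $f<g$ if and only if $f^\beta<g^\beta$. Suppose $n\ge 3$. Then for every $\beta\in B_{n-1}$ there exists $\alpha$ in the subsemigroup of $B_n$ generated by $A_{1,n},\dots,A_{n-1,n}$ such that $\beta\alpha\in B_n$ is order-preserving. -/

import Mathlib

namespace OrderedBraid

/-! ## Bi-orderings and order-preserving automorphisms -/

/-- `lt` is a bi-ordering of the group `G`: a strict total ordering that is invariant under
multiplication on the left and on the right. -/
structure IsBiOrdering {G : Type*} [Group G] (lt : G → G → Prop) : Prop where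
  irrefl : ∀ f, ¬ lt f f
  trans : ∀ f g h, lt f g → lt g h → lt f h
  total : ∀ f g, lt f g ∨ f = g ∨ lt g f
  mul_left : ∀ f g h, lt f g → lt (h * f) (h * g)
  mul_right : ∀ f g h, lt f g → lt (f * h) (g * h)

/-- An automorphism of a group is order-preserving if it leaves some bi-ordering invariant. -/
def IsOrderPreservingAut {G : Type*} [Group G] (φ : MulAut G) : Prop :=
  ∃ lt : G → G → Prop, IsBiOrdering lt ∧ ∀ f g, lt f g ↔ lt (φ f) (φ g)

/-! ## Braid groups

Strands and generators are numbered from `0`: the element `k` of `Fin n` is the strand `k + 1`, and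
the element `i` of `Fin (n - 1)` is the generator `σ_{i+1}`, which involves the strands numbered
`i` and `i + 1`. -/

/-- The braid relators: `σ_i σ_{i+1} σ_i = σ_{i+1} σ_i σ_{i+1}`, and `σ_i σ_j = σ_j σ_i` for
`|i - j| > 1`. -/
def braidRels (n : ℕ) : Set (FreeGroup (Fin (n - 1))) :=
  {r | (∃ i j : Fin (n - 1), (i : ℕ) + 1 = (j : ℕ) ∧
          r = (.of i * .of j * .of i) * (.of j * .of i * .of j)⁻¹) ∨
       (∃ i j : Fin (n - 1), ((i : ℕ) + 1 < (j : ℕ) ∨ (j : ℕ) + 1 < (i : ℕ)) ∧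
          r = (.of i * .of j) * (.of j * .of i)⁻¹)}

/-- The braid group `B_n` on `n` strands. -/
abbrev BraidGroup (n : ℕ) : Type := PresentedGroup (braidRels n)

/-- The standard generators of `B_n`. -/
def sigma {n : ℕ} (i : Fin (n - 1)) : BraidGroup n := PresentedGroup.of i

theorem sigma_braid {n : ℕ} (i j : Fin (n - 1)) (h : (i : ℕ) + 1 = (j : ℕ)) :
    sigma i * sigma j * sigma i = sigma j * sigma i * sigma j := by
  have : PresentedGroup.mk (braidRels n)
      ((.of i * .of j * .of i) * (.of j * .of i * .of j)⁻¹) = 1 :=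
    PresentedGroup.one_of_mem (Or.inl ⟨i, j, h, rfl⟩)
  rw [map_mul, map_inv, mul_inv_eq_one] at this
  simp only [map_mul] at this
  exact this

theorem sigma_comm {n : ℕ} (i j : Fin (n - 1))
    (h : (i : ℕ) + 1 < (j : ℕ) ∨ (j : ℕ) + 1 < (i : ℕ)) :
    (sigma i * sigma j : BraidGroup n) = sigma j * sigma i := by
  have : PresentedGroup.mk (braidRels n) ((.of i * .of j) * (.of j * .of i)⁻¹) = 1 :=
    PresentedGroup.one_of_mem (Or.inr ⟨i, j, h, rfl⟩)
  rw [map_mul, map_inv, mul_inv_eq_one] at this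
  simp only [map_mul] at this
  exact this

/-- The standard homomorphism `B_m → B_n` for `m ≤ n`, `σ_i ↦ σ_i`, by which `B_m` is regarded as
a subgroup of `B_n` (adding trivial strands at the end). -/
def braidIncl {m n : ℕ} (h : m ≤ n) : BraidGroup m →* BraidGroup n :=
  PresentedGroup.toGroup (f := fun i : Fin (m - 1) => sigma (Fin.castLE (by omega) i)) (by
    rintro r (⟨i, j, hij, rfl⟩ | ⟨i, j, hij, rfl⟩)
    · simp only [map_mul, map_inv, FreeGroup.lift_apply_of]
      rw [mul_inv_eq_one]
      exact sigma_braid _ _ (by simpa using hij)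
    · simp only [map_mul, map_inv, FreeGroup.lift_apply_of]
      rw [mul_inv_eq_one]
      exact sigma_comm _ _ (by simpa using hij))

/-- The pure braid
`A_{i,j} = σ_{j-1} ⋯ σ_{i+1} σ_i² σ_{i+1}⁻¹ ⋯ σ_{j-1}⁻¹`, for strands `i < j`. -/
def pureGen {n : ℕ} (i j : Fin n) (hij : i < j) : BraidGroup n :=
  let c : BraidGroup n :=
    (List.ofFn fun t : Fin ((j : ℕ) - 1 - (i : ℕ)) =>
      sigma ⟨(j : ℕ) - 1 - (t : ℕ), by omega⟩).prod
  c * sigma ⟨(i : ℕ), by omega⟩ ^ 2 * c⁻¹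

/-! ## The Artin action on the free group -/

/-- The free group `F_n` on `x_1, …, x_n`. -/
abbrev F (n : ℕ) : Type := FreeGroup (Fin n)

/-- The first strand involved in a generator. -/
def lo {n : ℕ} (i : Fin (n - 1)) : Fin n := ⟨(i : ℕ), by omega⟩

/-- The second strand involved in a generator. -/
def hi {n : ℕ} (i : Fin (n - 1)) : Fin n := ⟨(i : ℕ) + 1, by omega⟩

/-- The endomorphism `x_i ↦ x_i x_{i+1} x_i⁻¹`, `x_{i+1} ↦ x_i`, `x_j ↦ x_j` for `j ≠ i, i+1`. -/
def artinHom {n : ℕ} (i : Fin (n - 1)) : F n →* F n :=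
  FreeGroup.lift fun j =>
    if j = lo i then .of (lo i) * .of (hi i) * (.of (lo i))⁻¹
    else if j = hi i then .of (lo i)
    else .of j

/-- The inverse of `artinHom i`: `x_i ↦ x_{i+1}`, `x_{i+1} ↦ x_{i+1}⁻¹ x_i x_{i+1}`. -/
def artinInvHom {n : ℕ} (i : Fin (n - 1)) : F n →* F n :=
  FreeGroup.lift fun j =>
    if j = lo i then .of (hi i)
    else if j = hi i then (.of (hi i))⁻¹ * .of (lo i) * .of (hi i)
    else .of j

theorem hi_ne_lo {n : ℕ} (i : Fin (n - 1)) : hi i ≠ lo i := by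
  simp [hi, lo]

theorem artinHom_lo {n : ℕ} (i : Fin (n - 1)) :
    artinHom i (.of (lo i)) = .of (lo i) * .of (hi i) * (.of (lo i))⁻¹ := by
  simp [artinHom]

theorem artinHom_hi {n : ℕ} (i : Fin (n - 1)) : artinHom i (.of (hi i)) = .of (lo i) := by
  simp [artinHom, hi_ne_lo]

theorem artinHom_of_ne {n : ℕ} (i : Fin (n - 1)) (j : Fin n) (h₁ : j ≠ lo i) (h₂ : j ≠ hi i) :
    artinHom i (.of j) = .of j := by
  simp [artinHom, h₁, h₂]

/-- The automorphism of `F_n` by which the generator `sigma i` acts. -/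
def artinGen {n : ℕ} (i : Fin (n - 1)) : MulAut (F n) :=
  MonoidHom.toMulEquiv (artinHom i) (artinInvHom i)
    (by
      ext j
      by_cases h₁ : j = lo i
      · subst h₁; simp [artinHom, artinInvHom, hi_ne_lo]; group
      by_cases h₂ : j = hi i
      · subst h₂; simp [artinHom, artinInvHom, hi_ne_lo]
      simp [artinHom, artinInvHom, h₁, h₂])
    (by
      ext j
      by_cases h₁ : j = lo i
      · subst h₁; simp [artinHom, artinInvHom, hi_ne_lo]
      by_cases h₂ : j = hi i
      · subst h₂; simp [artinHom, artinInvHom, hi_ne_lo]; group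
      simp [artinHom, artinInvHom, h₁, h₂])

theorem artinGen_apply {n : ℕ} (i : Fin (n - 1)) (x : F n) : artinGen i x = artinHom i x := rfl

theorem artinHom_comm {n : ℕ} (i j : Fin (n - 1))
    (h : (i : ℕ) + 1 < (j : ℕ) ∨ (j : ℕ) + 1 < (i : ℕ)) :
    (artinHom i).comp (artinHom j) = (artinHom j).comp (artinHom i) := by
  have e₁ : lo i ≠ lo j := by simp only [lo, ne_eq, Fin.mk.injEq]; omega
  have e₂ : lo i ≠ hi j := by simp only [lo, hi, ne_eq, Fin.mk.injEq]; omega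
  have e₃ : hi i ≠ lo j := by simp only [lo, hi, ne_eq, Fin.mk.injEq]; omega
  have e₄ : hi i ≠ hi j := by simp only [hi, ne_eq, Fin.mk.injEq]; omega
  ext k
  simp only [MonoidHom.comp_apply]
  by_cases h₁ : k = lo i
  · subst h₁
    simp [artinHom_lo, artinHom_of_ne j _ e₁ e₂, artinHom_of_ne j _ e₃ e₄]
  by_cases h₂ : k = hi i
  · subst h₂
    simp [artinHom_hi, artinHom_of_ne j _ e₁ e₂, artinHom_of_ne j _ e₃ e₄]
  by_cases h₃ : k = lo j
  · subst h₃
    simp [artinHom_lo, artinHom_of_ne i _ e₁.symm e₃.symm, artinHom_of_ne i _ e₂.symm e₄.symm]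
  by_cases h₄ : k = hi j
  · subst h₄
    simp [artinHom_hi, artinHom_of_ne i _ e₁.symm e₃.symm, artinHom_of_ne i _ e₂.symm e₄.symm]
  simp [artinHom_of_ne i k h₁ h₂, artinHom_of_ne j k h₃ h₄]

theorem artinHom_braid {n : ℕ} (i j : Fin (n - 1)) (h : (i : ℕ) + 1 = (j : ℕ)) :
    (artinHom i).comp ((artinHom j).comp (artinHom i)) =
      (artinHom j).comp ((artinHom i).comp (artinHom j)) := by
  have e : lo j = hi i := by simp only [lo, hi, Fin.mk.injEq]; omega
  have e₁ : lo i ≠ hi i := (hi_ne_lo i).symm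
  have e₂ : hi j ≠ lo i := by simp only [lo, hi, ne_eq, Fin.mk.injEq]; omega
  have e₃ : hi j ≠ hi i := by simp only [hi, ne_eq, Fin.mk.injEq]; omega
  have a₁ := artinHom_lo i
  have a₂ := artinHom_hi i
  have a₃ : artinHom i (.of (hi j)) = .of (hi j) := artinHom_of_ne i _ e₂ e₃
  have b₁ := artinHom_lo j
  have b₂ := artinHom_hi j
  have b₃ : artinHom j (.of (lo i)) = .of (lo i) :=
    artinHom_of_ne j _ (by rw [e]; exact e₁) e₂.symm
  rw [e] at b₁ b₂
  ext k
  simp only [MonoidHom.comp_apply]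
  by_cases h₁ : k = lo i
  · subst h₁; simp [a₁, a₂, a₃, b₁, b₃, mul_assoc]
  by_cases h₂ : k = hi i
  · subst h₂; simp [a₁, a₂, a₃, b₁, b₂, b₃]
  by_cases h₃ : k = hi j
  · subst h₃; simp [a₂, a₃, b₂, b₃]
  have ci := artinHom_of_ne i k h₁ h₂
  have cj := artinHom_of_ne j k (by rw [e]; exact h₂) h₃
  simp [ci, cj]

/-- The Artin action of `B_n` on `F_n`. It is a right action, `x^{βγ} = (x^β)^γ`, that is, a
homomorphism to the opposite of the automorphism group. -/
def artin (n : ℕ) : BraidGroup n →* (MulAut (F n))ᵐᵒᵖ :=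
  PresentedGroup.toGroup (f := fun i : Fin (n - 1) => MulOpposite.op (artinGen i)) (by
    rintro r (⟨i, j, hij, rfl⟩ | ⟨i, j, hij, rfl⟩)
    · simp only [map_mul, map_inv, FreeGroup.lift_apply_of]
      rw [mul_inv_eq_one]
      apply MulOpposite.unop_injective
      ext x
      exact DFunLike.congr_fun (artinHom_braid i j hij) x
    · simp only [map_mul, map_inv, FreeGroup.lift_apply_of]
      rw [mul_inv_eq_one]
      apply MulOpposite.unop_injective
      ext x
      exact (DFunLike.congr_fun (artinHom_comm i j hij) x).symm)

/-- The automorphism `x ↦ x^β` of `F_n` induced by a braid `β`. -/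
def artinAut {n : ℕ} (β : BraidGroup n) : MulAut (F n) := (artin n β).unop

/-- A braid `β ∈ B_n` is order-preserving if the automorphism of `F_n` that it induces is
order-preserving. -/
def IsOrderPreserving {n : ℕ} (β : BraidGroup n) : Prop :=
  IsOrderPreservingAut (artinAut β)

end OrderedBraid

/-! Put `m = n - 1` and let `z` be the last generator of `F (m + 1)`. The kernel `K` of the exponent
sum in `z` is free on the elements `z ^ k * x_i * z ^ (-k)`, indexed by pairs `(k, i)` in `CoverIdx
m`, and `F (m + 1)` is the semidirect product of `K` with the infinite cyclic group generated by
`z`. The braids that occur preserve the exponent sum in `z`, hence act on `K`, and on the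
abelianization of `K` they permute the basis (`IsMonomial`): a braid from `B_m` acts by `(k, i) ↦
(k, π i)`, and `A_{a,n}` raises `k` by one when `i = a` and fixes all other pairs. If `α` is the
product of the `A_{a,n}` with `a ∈ T`, then `βα` acts by `(k, i) ↦ (k + [π i ∈ T], π i)`.

Let `T` contain exactly one point of each cycle of `π`. For a cycle of length `ℓ`, unroll the pairs
over it into a copy of `ℤ` by `(k, i) ↦ kℓ + p`, where `p < ℓ` is the position of `i` on the cycle.
There `βα` acts as translation by `1`, and conjugation by `z` as translation by `ℓ`. So one linear
order on the basis makes both strictly monotone (`exists_linearOrder_coverIdx`).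

An ordered basis gives the Magnus bi-ordering of a free group: `g` is positive if the least word in
the lowest-degree part of its Magnus expansion minus `1` has a positive coefficient. An endomorphism
that acts on the abelianization by a monotone relabelling of the basis just relabels the variables
of this lowest-degree part, so it preserves positivity (`MagnusPos.map`). The resulting ordering of
`K` is invariant under `z`, extends lexicographically to `F (m + 1)`, and is preserved by `βα`
(`IsMonomial.isOrderPreservingAut`). -/

namespace OrderedBraid

open PowerSeries

/-! ## Substitution of power series with central variable -/

section Substitution

variable {A B : Type*} [Ring A] [Ring B]

/-- The additive extension `∑ a_d X^d ↦ ∑ θ(a_d) X^d` of a homomorphism `θ : A → B⟦X⟧`. -/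
noncomputable def extendSeriesAdd (θ : A →+* B⟦X⟧) : A⟦X⟧ →+ B⟦X⟧ where
  toFun p := PowerSeries.mk fun m =>
    ∑ ij ∈ Finset.HasAntidiagonal.antidiagonal m, coeff ij.1 (θ (coeff ij.2 p))
  map_zero' := by ext; simp
  map_add' p q := by ext; simp [Finset.sum_add_distrib]

theorem coeff_extendSeriesAdd (θ : A →+* B⟦X⟧) (m : ℕ) (p : A⟦X⟧) :
    coeff m (extendSeriesAdd θ p) =
      ∑ ij ∈ Finset.HasAntidiagonal.antidiagonal m, coeff ij.1 (θ (coeff ij.2 p)) := by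
  simp [extendSeriesAdd]

theorem extendSeriesAdd_C (θ : A →+* B⟦X⟧) (a : A) : extendSeriesAdd θ (C a) = θ a := by
  ext m
  rw [coeff_extendSeriesAdd, Finset.sum_eq_single (m, 0)]
  · simp
  · rintro ⟨i, j⟩ h1 h2
    have : j ≠ 0 := by
      rintro rfl
      simp at h1
      exact h2 (by simp [h1])
    simp [coeff_C, this]
  · simp

theorem extendSeriesAdd_X_mul (θ : A →+* B⟦X⟧) (p : A⟦X⟧) :
    extendSeriesAdd θ (X * p) = X * extendSeriesAdd θ p := by
  ext m
  cases m with
  | zero => simp [coeff_extendSeriesAdd]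
  | succ m =>
    rw [coeff_extendSeriesAdd, coeff_succ_X_mul, coeff_extendSeriesAdd,
      Finset.Nat.sum_antidiagonal_succ']
    simp [coeff_succ_X_mul]

theorem eq_C_add_X_mul (p : A⟦X⟧) : ∃ (a : A) (q : A⟦X⟧), p = C a + X * q :=
  ⟨constantCoeff p, PowerSeries.mk fun m => coeff (m + 1) p, by
    ext m
    cases m with
    | zero => simp
    | succ m => simp [coeff_succ_X_mul]⟩

/-- Since `X` is central, splitting off the constant term of `p` reduces each coefficient to the
preceding one. The same peeling, applied to the left factor, gives `extendSeriesAdd_mul`. -/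
theorem extendSeriesAdd_C_mul (θ : A →+* B⟦X⟧) (a : A) (p : A⟦X⟧) :
    extendSeriesAdd θ (C a * p) = θ a * extendSeriesAdd θ p := by
  have hC : ∀ b, extendSeriesAdd θ (C a * C b) = θ a * θ b := fun b => by
    rw [← map_mul C, extendSeriesAdd_C, map_mul]
  ext m
  induction m generalizing p with
  | zero =>
    obtain ⟨b, q, rfl⟩ := eq_C_add_X_mul p
    rw [mul_add, ← mul_assoc, ← X_mul (φ := C a), mul_assoc]
    simp only [map_add, hC, extendSeriesAdd_C, extendSeriesAdd_X_mul, mul_add]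
    rw [← mul_assoc (θ a) X, ← X_mul (φ := θ a), mul_assoc X]
    simp
  | succ m ih =>
    obtain ⟨b, q, rfl⟩ := eq_C_add_X_mul p
    rw [mul_add, ← mul_assoc, ← X_mul (φ := C a), mul_assoc]
    simp only [map_add, hC, extendSeriesAdd_C, extendSeriesAdd_X_mul, mul_add]
    rw [← mul_assoc (θ a) X, ← X_mul (φ := θ a), mul_assoc X, coeff_succ_X_mul,
      coeff_succ_X_mul, ih]

theorem extendSeriesAdd_mul (θ : A →+* B⟦X⟧) (p q : A⟦X⟧) :
    extendSeriesAdd θ (p * q) = extendSeriesAdd θ p * extendSeriesAdd θ q := by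
  ext m
  induction m generalizing p with
  | zero =>
    obtain ⟨a, p, rfl⟩ := eq_C_add_X_mul p
    simp only [add_mul, mul_assoc, map_add, extendSeriesAdd_C_mul, extendSeriesAdd_X_mul,
      extendSeriesAdd_C]
    simp
  | succ m ih =>
    obtain ⟨a, p, rfl⟩ := eq_C_add_X_mul p
    simp only [add_mul, mul_assoc, map_add, extendSeriesAdd_C_mul, extendSeriesAdd_X_mul,
      extendSeriesAdd_C, coeff_succ_X_mul, ih]

/-- The extension `A⟦X⟧ → B⟦X⟧`, `X ↦ X`, of a homomorphism `A → B⟦X⟧`. -/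
noncomputable def extendSeries (θ : A →+* B⟦X⟧) : A⟦X⟧ →+* B⟦X⟧ :=
  { extendSeriesAdd θ with
    map_one' := by
      have := extendSeriesAdd_C θ 1
      rwa [map_one C, map_one θ] at this
    map_mul' := extendSeriesAdd_mul θ }

theorem extendSeries_C (θ : A →+* B⟦X⟧) (a : A) : extendSeries θ (C a) = θ a :=
  extendSeriesAdd_C θ a

theorem extendSeries_X (θ : A →+* B⟦X⟧) : extendSeries θ X = X := by
  have := extendSeriesAdd_X_mul θ 1
  have h1 : extendSeriesAdd θ 1 = 1 := (extendSeries θ).map_one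
  rw [h1, mul_one, mul_one] at this
  exact this

theorem constantCoeff_extendSeries (θ : A →+* B⟦X⟧) (p : A⟦X⟧) :
    constantCoeff (extendSeries θ p) = constantCoeff (θ (constantCoeff p)) := by
  rw [← coeff_zero_eq_constantCoeff_apply]
  change coeff 0 (extendSeriesAdd θ p) = _
  simp [coeff_extendSeriesAdd]

end Substitution

/-! ## The Magnus expansion -/

section Magnus

variable {S : Type*}

/-- The ring of polynomials with integer coefficients in non-commuting variables. -/
abbrev NCPoly (S : Type*) : Type _ := MonoidAlgebra ℤ (FreeMonoid S)

/-- A variable of `NCPoly S`. -/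
noncomputable def ncVar (s : S) : NCPoly S := MonoidAlgebra.single (FreeMonoid.of s) 1

/-- The unit `1 + Y_s X`. -/
noncomputable def magnusUnit (s : S) : (NCPoly S)⟦X⟧ˣ where
  val := 1 + X * C (ncVar s)
  inv := invOfUnit (1 + X * C (ncVar s)) 1
  val_inv := mul_invOfUnit _ _ (by simp)
  inv_val := invOfUnit_mul _ _ (by simp)

/-- The Magnus expansion `y_s ↦ 1 + Y_s X` of the free group; the powers of `X` record the
degree. -/
noncomputable def magnus : FreeGroup S →* (NCPoly S)⟦X⟧ˣ := FreeGroup.lift magnusUnit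

theorem magnus_of (s : S) : (magnus (.of s) : (NCPoly S)⟦X⟧) = 1 + X * C (ncVar s) := by
  simp [magnus, magnusUnit]

theorem constantCoeff_magnus (g : FreeGroup S) :
    constantCoeff (magnus g : (NCPoly S)⟦X⟧) = 1 := by
  have : (Units.map (constantCoeff (R := NCPoly S)).toMonoidHom).comp magnus = 1 := by
    ext s : 1
    apply Units.ext
    simp [magnus_of]
  simpa using congrArg Units.val (DFunLike.congr_fun this g)

/-- Coefficient of the word `w` in its own degree. -/
noncomputable def wordCoeff (w : FreeMonoid S) (p : (NCPoly S)⟦X⟧) : ℤ :=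
  (coeff w.length p).coeff w

theorem wordCoeff_one (s : S) (w : FreeMonoid S) : wordCoeff (.of s * w) 1 = 0 := by
  simp [wordCoeff, coeff_one]

/-- `u` acts on coefficients like `(1 + Y_s X) ^ e` does, as far as words are concerned in which
the letter `s` is not repeated. -/
def IsSyllable (s : S) (e : ℤ) (u : (NCPoly S)⟦X⟧ˣ) : Prop :=
  ∀ (p : (NCPoly S)⟦X⟧) (w : FreeMonoid S), (∀ v, FreeMonoid.of s * v ≠ w) →
    wordCoeff w (u.val * p) = wordCoeff w p ∧
    wordCoeff (.of s * w) (u.val * p) = wordCoeff (.of s * w) p + e * wordCoeff w p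

theorem IsSyllable.one (s : S) : IsSyllable s 0 1 := by
  intro p w _
  simp

theorem IsSyllable.mul {s : S} {e e' : ℤ} {u u' : (NCPoly S)⟦X⟧ˣ} (h : IsSyllable s e u)
    (h' : IsSyllable s e' u') : IsSyllable s (e + e') (u * u') := by
  intro p w hw
  rw [Units.val_mul, mul_assoc, (h _ w hw).1, (h _ w hw).2, (h' p w hw).1, (h' p w hw).2]
  exact ⟨rfl, by ring⟩

/-- Both identities for `u` are applied to `u⁻¹ * p` and solved for the coefficients of `u⁻¹ * p`,
so negative powers need no series expansion. -/
theorem IsSyllable.inv {s : S} {e : ℤ} {u : (NCPoly S)⟦X⟧ˣ} (h : IsSyllable s e u) :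
    IsSyllable s (-e) u⁻¹ := by
  intro p w hw
  obtain ⟨h1, h2⟩ := h (u⁻¹.val * p) w hw
  rw [← mul_assoc, Units.mul_inv, one_mul] at h1 h2
  rw [h2, h1]
  exact ⟨rfl, by ring⟩

theorem isSyllable_magnusUnit (s : S) : IsSyllable s 1 (magnusUnit s) := by
  intro p w hw
  have hu : ((magnusUnit s : (NCPoly S)⟦X⟧ˣ) : (NCPoly S)⟦X⟧) = 1 + X * C (ncVar s) := rfl
  have hc : ∀ m, coeff (m + 1) (X * C (ncVar s) * p) = ncVar s * coeff m p := by
    intro m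
    rw [mul_assoc, coeff_succ_X_mul, coeff_C_mul]
  constructor
  · rw [hu, add_mul, one_mul]
    simp only [wordCoeff]
    rcases h : w.length with _ | m
    · simp [mul_assoc]
    · rw [map_add, hc]
      simp only [MonoidAlgebra.coeff_add, Finsupp.add_apply, ncVar]
      rw [MonoidAlgebra.coeff_single_mul_of_forall_mul_ne _ _ hw, add_zero]
  · rw [hu, add_mul, one_mul]
    have hl : (FreeMonoid.of s * w).length = w.length + 1 := by
      simp [add_comm]
    simp only [wordCoeff]
    rw [hl, map_add, hc]
    simp only [MonoidAlgebra.coeff_add, Finsupp.add_apply, ncVar]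
    rw [MonoidAlgebra.coeff_single_mul_eq_mul_coeff w]
    intro m' _
    exact mul_right_inj _

theorem IsSyllable.pow {s : S} {u : (NCPoly S)⟦X⟧ˣ} (h : IsSyllable s 1 u) (k : ℕ) :
    IsSyllable s k (u ^ k) := by
  induction k with
  | zero => simpa using IsSyllable.one s
  | succ k ih => simpa [pow_succ] using ih.mul h

theorem IsSyllable.zpow {s : S} {u : (NCPoly S)⟦X⟧ˣ} (h : IsSyllable s 1 u) (k : ℤ) :
    IsSyllable s k (u ^ k) := by
  obtain ⟨k, rfl | rfl⟩ := k.eq_nat_or_neg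
  · simpa using h.pow k
  · simpa using (h.pow k).inv

/-! ### Injectivity of the Magnus expansion -/

open Monoid in
/-- The Magnus expansion of a free product of infinite cyclic groups. -/
noncomputable def magnusCoprod : CoprodI (fun _ : S => Multiplicative ℤ) →* (NCPoly S)⟦X⟧ˣ :=
  CoprodI.lift fun s => zpowersHom _ (magnusUnit s)

/-- The word formed by the indices of the syllables. -/
def indexWord (w : Monoid.CoprodI.Word (fun _ : S => Multiplicative ℤ)) : FreeMonoid S :=
  FreeMonoid.ofList (w.toList.map Sigma.fst)

/-- The words without repeated adjacent letters. -/
def IsStutterFree (v : FreeMonoid S) : Prop := v.toList.IsChain (· ≠ ·)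

theorem isStutterFree_indexWord (w : Monoid.CoprodI.Word (fun _ : S => Multiplicative ℤ)) :
    IsStutterFree (indexWord w) :=
  (List.isChain_map _).2 w.chain_ne

theorem of_mul_ne_of_isStutterFree {s : S} {w : FreeMonoid S} (h : IsStutterFree (.of s * w)) :
    ∀ v, FreeMonoid.of s * v ≠ w := by
  rintro v rfl
  simp [IsStutterFree] at h

theorem IsStutterFree.of_mul {s : S} {w : FreeMonoid S} (h : IsStutterFree (.of s * w)) :
    IsStutterFree w := by
  simp only [IsStutterFree, FreeMonoid.toList_of_mul] at h ⊢
  exact h.tail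

open Monoid in
-- For a reduced product of syllables `y_{s_1}^{e_1} ⋯ y_{s_r}^{e_r}` the coefficient of `Y_{s_1} ⋯
-- Y_{s_r}` is `e_1 ⋯ e_r`, which is nonzero. The vanishing at longer stutter-free words is what
-- lets the induction discard the other summand.
theorem wordCoeff_magnusCoprod (w : CoprodI.Word (fun _ : S => Multiplicative ℤ)) :
    (∀ v, IsStutterFree v → (indexWord w).length < v.length →
      wordCoeff v (magnusCoprod w.prod : (NCPoly S)⟦X⟧) = 0) ∧
    wordCoeff (indexWord w) (magnusCoprod w.prod : (NCPoly S)⟦X⟧) ≠ 0 := by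
  induction w using CoprodI.Word.consRecOn with
  | empty =>
    constructor
    · intro v _ hl
      induction v using FreeMonoid.casesOn with
      | one => simp at hl
      | of_mul s v => simpa using wordCoeff_one s v
    · rw [CoprodI.Word.prod_empty, map_one]
      simp [indexWord, CoprodI.Word.empty, wordCoeff, MonoidAlgebra.one_def]
  | cons i m w h1 h2 ih =>
    obtain ⟨ih1, ih2⟩ := ih
    have hs : IsSyllable i (Multiplicative.toAdd m) (magnusCoprod (CoprodI.of (i := i) m)) := by
      simpa [magnusCoprod] using (isSyllable_magnusUnit i).zpow (Multiplicative.toAdd m)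
    have hi : indexWord (CoprodI.Word.cons m w h1 h2) = .of i * indexWord w := rfl
    have hst := isStutterFree_indexWord (CoprodI.Word.cons m w h1 h2)
    rw [CoprodI.Word.prod_cons, map_mul, Units.val_mul, hi]
    rw [hi] at hst
    constructor
    · intro v hv hl
      by_cases hvi : ∃ v', FreeMonoid.of i * v' = v
      · obtain ⟨v, rfl⟩ := hvi
        rw [(hs _ v (of_mul_ne_of_isStutterFree hv)).2, ih1 v hv.of_mul (by simpa using hl),
          ih1 _ hv (by simp at hl ⊢; omega)]
        simp
      · push Not at hvi
        rw [(hs _ v hvi).1, ih1 v hv (by simp at hl ⊢; omega)]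
    -- The full index word is too long to occur in the tail, so only the exponent times the tail's
    -- coefficient survives.
    · rw [(hs _ _ (of_mul_ne_of_isStutterFree hst)).2, ih1 _ hst (by simp), zero_add]
      exact mul_ne_zero (fun h => h2 (by simpa using h)) ih2

open Monoid in
theorem magnusCoprod_injective : Function.Injective (magnusCoprod (S := S)) := by
  classical
  rw [injective_iff_map_eq_one]
  intro g hg
  obtain ⟨w, rfl⟩ : ∃ w : CoprodI.Word (fun _ : S => Multiplicative ℤ), w.prod = g :=
    ⟨CoprodI.Word.equiv g, CoprodI.Word.equiv.symm_apply_apply g⟩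
  have h := (wordCoeff_magnusCoprod w).2
  rw [hg] at h
  induction w using CoprodI.Word.consRecOn with
  | empty => simp
  | cons i m w h1 h2 _ => exact absurd (wordCoeff_one i (indexWord w)) h

open Monoid in
theorem magnus_injective : Function.Injective (magnus (S := S)) := by
  let a : FreeGroup S →* CoprodI (fun _ : S => Multiplicative ℤ) :=
    FreeGroup.lift fun s => CoprodI.of (i := s) (Multiplicative.ofAdd 1)
  let b : CoprodI (fun _ : S => Multiplicative ℤ) →* FreeGroup S :=
    CoprodI.lift fun s => zpowersHom _ (.of s)
  have hba : b.comp a = MonoidHom.id _ := by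
    ext s
    simp [a, b]
  have hm : (magnus (S := S)) = magnusCoprod.comp a := by
    ext s : 1
    simp [a, magnus, magnusCoprod]
  rw [hm]
  refine magnusCoprod_injective.comp (Function.LeftInverse.injective (g := b) fun x => ?_)
  exact DFunLike.congr_fun hba x

end Magnus

end OrderedBraid

namespace OrderedBraid

open PowerSeries

/-! ## Positive cones -/

section Cone

/-- `P` is the set of positive elements of a bi-ordering. -/
structure IsPosCone {G : Type*} [Group G] (P : G → Prop) : Prop where
  not_one : ¬ P 1
  mul : ∀ f g, P f → P g → P (f * g)
  total : ∀ g, g ≠ 1 → P g ∨ P g⁻¹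
  conj : ∀ g h, P g → P (h * g * h⁻¹)

variable {G H : Type*} [Group G] [Group H] {P : G → Prop}

theorem IsPosCone.isBiOrdering (hP : IsPosCone P) : IsBiOrdering fun f g => P (f⁻¹ * g) where
  irrefl f := by simpa using hP.not_one
  trans f g h h₁ h₂ := by simpa [mul_assoc] using hP.mul _ _ h₁ h₂
  total f g := by
    by_cases h : f = g
    · exact Or.inr (Or.inl h)
    · rcases hP.total (f⁻¹ * g) (by rwa [ne_eq, inv_mul_eq_one]) with h | h
      · exact Or.inl h
      · exact Or.inr (Or.inr (by simpa using h))
  mul_left f g h hfg := by simpa [mul_assoc] using hfg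
  mul_right f g h hfg := by simpa [mul_assoc] using hP.conj _ h⁻¹ hfg

/-- The forward implication suffices: if `φ g` is positive and `g` is not, then `g⁻¹` is positive,
and `φ g * φ g⁻¹ = 1` would be positive. -/
theorem IsPosCone.isOrderPreservingAut (hP : IsPosCone P) (φ : MulAut G)
    (h : ∀ g, P g → P (φ g)) : IsOrderPreservingAut φ := by
  have h' : ∀ g, P (φ g) → P g := by
    intro g hg
    by_contra hn
    have h1 : g ≠ 1 := by
      rintro rfl
      exact hP.not_one (by simpa using hg)
    have := hP.mul _ _ hg (h _ ((hP.total g h1).resolve_left hn))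
    exact hP.not_one (by simpa using this)
  refine ⟨_, hP.isBiOrdering, fun f g => ?_⟩
  rw [← map_inv, ← map_mul]
  exact ⟨h _, h' _⟩

theorem IsPosCone.comap {Q : H → Prop} (hQ : IsPosCone Q) (ψ : G →* H)
    (hψ : Function.Injective ψ) : IsPosCone fun g => Q (ψ g) where
  not_one := by simpa using hQ.not_one
  mul f g hf hg := by simpa using hQ.mul _ _ hf hg
  total g hg := by simpa using hQ.total (ψ g) (by rwa [ne_eq, map_eq_one_iff ψ hψ])
  conj g h hg := by simpa using hQ.conj _ (ψ h) hg

/-- The lexicographic positive cone on a semidirect product with an infinite cyclic group. -/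
def semidirectPos {α : Multiplicative ℤ →* MulAut G} (P : G → Prop)
    (g : G ⋊[α] Multiplicative ℤ) : Prop :=
  0 < Multiplicative.toAdd g.right ∨ (g.right = 1 ∧ P g.left)

/-- Conjugation acts on the normal factor by an inner automorphism composed with some `α k`; this is
where the invariance `hα` enters. -/
theorem IsPosCone.semidirect {α : Multiplicative ℤ →* MulAut G} (hP : IsPosCone P)
    (hα : ∀ k g, P g → P (α k g)) : IsPosCone (semidirectPos (α := α) P) where
  not_one := by simpa [semidirectPos] using hP.not_one
  mul f g := by
    rintro (hf | ⟨hf, hf'⟩) (hg | ⟨hg, hg'⟩)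
    · left; simp; omega
    · left; simpa [hg] using hf
    · left; simpa [hf] using hg
    · right
      exact ⟨by simp [hf, hg], by simpa [hf] using hP.mul _ _ hf' hg'⟩
  total g hg := by
    rcases lt_trichotomy (Multiplicative.toAdd g.right) 0 with h | h | h
    · right; left; simpa using h
    · have h : g.right = 1 := h
      rcases hP.total g.left (fun h' => hg (SemidirectProduct.ext h' h)) with h' | h'
      · exact Or.inl (Or.inr ⟨h, h'⟩)
      · exact Or.inr (Or.inr ⟨by simp [h], by simpa [h] using h'⟩)
    · left; left; exact h
  conj g h := by
    rintro (hg | ⟨hg, hg'⟩)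
    · left; simpa using hg
    · right
      refine ⟨by simp [hg], ?_⟩
      have : (h * g * h⁻¹).left = h.left * α h.right g.left * h.left⁻¹ := by
        simp [hg]
      rw [this]
      exact hP.conj _ _ (hα _ _ hg')

end Cone

/-! ## Ordering the free group by leading terms of Magnus expansions -/

section MagnusOrder

variable {S : Type*} [LinearOrder S]

/-- The non-commutative polynomials whose coefficient at the least word that occurs is positive. -/
def NCPos (c : NCPoly S) : Prop :=
  ∃ w, 0 < c.coeff w ∧ ∀ v : FreeMonoid S, v.toList < w.toList → c.coeff v = 0

theorem not_ncPos_zero : ¬ NCPos (0 : NCPoly S) := by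
  rintro ⟨w, hw, _⟩
  simp at hw

theorem NCPos.add {c d : NCPoly S} (hc : NCPos c) (hd : NCPos d) : NCPos (c + d) := by
  obtain ⟨w, hw, hw'⟩ := hc
  obtain ⟨v, hv, hv'⟩ := hd
  rcases lt_trichotomy w.toList v.toList with h | h | h
  · exact ⟨w, by simpa [hv' w h] using hw, fun u hu => by simp [hw' u hu, hv' u (hu.trans h)]⟩
  · obtain rfl : w = v := FreeMonoid.toList.injective h
    exact ⟨w, by simpa using add_pos hw hv, fun u hu => by simp [hw' u hu, hv' u hu]⟩
  · exact ⟨v, by simpa [hw' v h] using hv, fun u hu => by simp [hv' u hu, hw' u (hu.trans h)]⟩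

/-- The lexicographic order on words is not well-founded, but the support is finite and so has a
least word. -/
theorem NCPos.total {c : NCPoly S} (hc : c ≠ 0) : NCPos c ∨ NCPos (-c) := by
  have hs : c.coeff.support.Nonempty := by
    rw [Finsupp.support_nonempty_iff]
    intro h
    exact hc (MonoidAlgebra.ext (by simp [h]))
  obtain ⟨w, hw, hmin⟩ := c.coeff.support.exists_min_image FreeMonoid.toList hs
  have hz : ∀ v : FreeMonoid S, v.toList < w.toList → c.coeff v = 0 := fun v hv => by
    by_contra hne
    exact absurd (hmin v (by simpa using hne)) (not_le.2 hv)
  rcases lt_or_gt_of_ne (Finsupp.mem_support_iff.1 hw) with h | h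
  · exact Or.inr ⟨w, by simpa using h, fun v hv => by simpa using hz v hv⟩
  · exact Or.inl ⟨w, h, hz⟩

theorem NCPos.map {f : S → S} (hf : StrictMono f) {c : NCPoly S} (hc : NCPos c) :
    NCPos (MonoidAlgebra.mapDomainRingHom ℤ (FreeMonoid.map f) c) := by
  obtain ⟨w, hw, hw'⟩ := hc
  have hmap : ∀ u v : FreeMonoid S, u.toList < v.toList →
      (FreeMonoid.map f u).toList < (FreeMonoid.map f v).toList := fun u v h => by
    simpa using List.map_lt (fun x y hxy => hf hxy) h
  have hinj : Function.Injective (FreeMonoid.map f) := fun u v h => by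
    rcases lt_trichotomy u.toList v.toList with h' | h' | h'
    · exact absurd (hmap _ _ h') (by simp [h])
    · exact FreeMonoid.toList.injective h'
    · exact absurd (hmap _ _ h') (by simp [h])
  refine ⟨FreeMonoid.map f w, ?_, fun v hv => ?_⟩
  · simpa [MonoidAlgebra.mapDomain, Finsupp.mapDomain_apply hinj] using hw
  · by_cases hr : v ∈ Set.range (FreeMonoid.map f)
    · obtain ⟨v, rfl⟩ := hr
      have : v.toList < w.toList := by
        rcases lt_trichotomy v.toList w.toList with h' | h' | h'
        · exact h'
        · rw [FreeMonoid.toList.injective h'] at hv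
          exact absurd hv (lt_irrefl _)
        · exact absurd (hmap _ _ h') (not_lt.2 hv.le)
      simpa [MonoidAlgebra.mapDomain, Finsupp.mapDomain_apply hinj] using hw' v this
    · simpa [MonoidAlgebra.mapDomain] using Finsupp.mapDomain_of_notMem_range _ _ hr

/-- The elements of the free group whose Magnus expansion has a positive leading term. -/
def MagnusPos (g : FreeGroup S) : Prop :=
  ∃ (d : ℕ) (q : (NCPoly S)⟦X⟧), (magnus g : (NCPoly S)⟦X⟧) = 1 + X ^ (d + 1) * q ∧
    NCPos (constantCoeff q)

theorem exists_magnus_eq {S : Type*} {g : FreeGroup S} (hg : g ≠ 1) :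
    ∃ (d : ℕ) (q : (NCPoly S)⟦X⟧), (magnus g : (NCPoly S)⟦X⟧) = 1 + X ^ (d + 1) * q ∧
      constantCoeff q ≠ 0 := by
  classical
  have hne : (magnus g : (NCPoly S)⟦X⟧) - 1 ≠ 0 := fun h => hg (magnus_injective (by
    rw [map_one]
    exact Units.ext (sub_eq_zero.1 h)))
  have hex : ∃ m, coeff m ((magnus g : (NCPoly S)⟦X⟧) - 1) ≠ 0 := by
    by_contra h
    push Not at h
    exact hne (PowerSeries.ext (by simpa using h))
  obtain ⟨q, hq⟩ := X_pow_dvd_iff.2 fun m hm => not_not.1 (Nat.find_min hex hm)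
  have hm := Nat.find_spec hex
  rcases h : Nat.find hex with _ | d
  · rw [h] at hm
    simp [constantCoeff_magnus] at hm
  · rw [h] at hm hq
    refine ⟨d, q, by rw [← hq]; abel, ?_⟩
    have h0 := coeff_X_pow_mul q (d + 1) 0
    rw [zero_add] at h0
    rwa [hq, h0, coeff_zero_eq_constantCoeff_apply] at hm

/-- In a product the leading term of lower degree wins, and leading terms of equal degree add.
Conjugation leaves the leading term unchanged because Magnus expansions have constant term `1`. So
`NCPos` need only be closed under addition and total. -/
theorem isPosCone_magnusPos : IsPosCone (MagnusPos (S := S)) where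
  not_one := by
    rintro ⟨d, q, h, hq⟩
    have h0 : X ^ (d + 1) * q = 0 := by simpa using h
    have : coeff 0 q = 0 := by
      rw [← coeff_X_pow_mul q (d + 1) 0, h0, map_zero]
    rw [← coeff_zero_eq_constantCoeff_apply, this] at hq
    exact not_ncPos_zero hq
  mul g h := by
    rintro ⟨d, q, hg, hq⟩ ⟨e, r, hh, hr⟩
    rcases lt_trichotomy d e with hde | rfl | hde
    · obtain ⟨k, rfl⟩ := Nat.exists_eq_add_of_lt hde
      refine ⟨d, q + X ^ (k + 1) * r + q * (X ^ (d + k + 1 + 1) * r), ?_, by simpa using hq⟩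
      rw [map_mul, Units.val_mul, hg, hh]
      have : (X : (NCPoly S)⟦X⟧) ^ (d + k + 1 + 1) = X ^ (d + 1) * X ^ (k + 1) := by
        rw [← pow_add]; congr 1; omega
      rw [this]
      noncomm_ring
    · refine ⟨d, q + r + q * (X ^ (d + 1) * r), ?_, by simpa using hq.add hr⟩
      rw [map_mul, Units.val_mul, hg, hh]
      noncomm_ring
    · obtain ⟨k, rfl⟩ := Nat.exists_eq_add_of_lt hde
      refine ⟨e, X ^ (k + 1) * q + r + X ^ (k + 1) * q * (X ^ (e + 1) * r), ?_,
        by simpa using hr⟩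
      rw [map_mul, Units.val_mul, hg, hh]
      have : (X : (NCPoly S)⟦X⟧) ^ (e + k + 1 + 1) = X ^ (e + 1) * X ^ (k + 1) := by
        rw [← pow_add]; congr 1; omega
      rw [this]
      noncomm_ring
  total g hg := by
    obtain ⟨d, q, h, hq⟩ := exists_magnus_eq hg
    rcases NCPos.total hq with hq | hq
    · exact Or.inl ⟨d, q, h, hq⟩
    -- The witness comes from expanding `magnus g * magnus g⁻¹ = 1` and solving for `magnus g⁻¹`.
    · refine Or.inr ⟨d, -(q * (magnus g⁻¹ : (NCPoly S)⟦X⟧)), ?_, ?_⟩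
      · have h1 : (magnus g : (NCPoly S)⟦X⟧) * (magnus g⁻¹ : (NCPoly S)⟦X⟧) = 1 := by
          rw [map_inv, Units.mul_inv]
        rw [h, add_mul, one_mul, mul_assoc] at h1
        rw [mul_neg, ← h1]
        abel
      · simpa [constantCoeff_magnus, -map_inv] using hq
  conj g h := by
    rintro ⟨d, q, hg, hq⟩
    refine ⟨d, magnus h * q * (magnus h⁻¹ : (NCPoly S)⟦X⟧), ?_, ?_⟩
    · have h1 : (magnus h : (NCPoly S)⟦X⟧) * (magnus h⁻¹ : (NCPoly S)⟦X⟧) = 1 := by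
        rw [map_inv, Units.mul_inv]
      rw [map_mul, map_mul, Units.val_mul, Units.val_mul, hg, mul_add, add_mul, mul_one, h1,
        ← mul_assoc (magnus h : (NCPoly S)⟦X⟧), ← X_pow_mul]
      simp only [mul_assoc]
    · simpa [constantCoeff_magnus, -map_inv] using hq

/-! ### Linear terms and the effect of endomorphisms on leading terms -/

/-- The vector of exponent sums. -/
noncomputable def expSum {S : Type*} : FreeGroup S →* Multiplicative (S →₀ ℤ) :=
  FreeGroup.lift fun s => .ofAdd (Finsupp.single s 1)

theorem expSum_of {S : Type*} (s : S) : expSum (.of s) = .ofAdd (Finsupp.single s 1) := by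
  simp [expSum]

theorem exists_magnus_eq_expSum {S : Type*} (g : FreeGroup S) :
    ∃ q : (NCPoly S)⟦X⟧, (magnus g : (NCPoly S)⟦X⟧) = 1 + X * q ∧
      constantCoeff q = Finsupp.linearCombination ℤ ncVar (Multiplicative.toAdd (expSum g)) := by
  induction g using FreeGroup.induction_on with
  | C1 => exact ⟨0, by simp⟩
  | of s => exact ⟨C (ncVar s), by simp [magnus_of], by simp [expSum_of]⟩
  | inv_of s _ =>
    refine ⟨-(C (ncVar s) * (magnus (.of s)⁻¹ : (NCPoly S)⟦X⟧)), ?_, ?_⟩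
    · have h1 : (magnus (.of s) : (NCPoly S)⟦X⟧) * (magnus (.of s)⁻¹ : (NCPoly S)⟦X⟧) = 1 := by
        rw [map_inv, Units.mul_inv]
      rw [magnus_of, add_mul, one_mul, mul_assoc] at h1
      rw [mul_neg, ← h1]
      abel
    · simp [constantCoeff_magnus, -map_inv, map_inv expSum, expSum_of]
  | mul g h hg hh =>
    obtain ⟨q, hg, hq⟩ := hg
    obtain ⟨r, hh, hr⟩ := hh
    refine ⟨q + r + q * (X * r), ?_, by simp [hq, hr]⟩
    rw [map_mul, Units.val_mul, hg, hh]
    noncomm_ring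

/-- The substitution `Y_s ↦ q s`, `X ↦ X` carries the expansion of `g` to that of `φ g`. Modulo `X`
it sends `Y_s` to `Y_{f s}`, by the formula for linear terms, so the leading coefficient is
relabelled by `f`. -/
theorem MagnusPos.map {f : S → S} (hf : StrictMono f) {φ : FreeGroup S →* FreeGroup S}
    (hφ : ∀ s, expSum (φ (.of s)) = .ofAdd (Finsupp.single (f s) 1)) {g : FreeGroup S}
    (hg : MagnusPos g) : MagnusPos (φ g) := by
  choose q hq hq' using fun s => exists_magnus_eq_expSum (φ (.of s))
  let θ : NCPoly S →+* (NCPoly S)⟦X⟧ :=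
    (MonoidAlgebra.lift ℤ (NCPoly S)⟦X⟧ (FreeMonoid S) (FreeMonoid.lift q)).toRingHom
  have hθ : ∀ s, θ (ncVar s) = q s := fun s => by
    simp only [θ, ncVar, AlgHom.toRingHom_eq_coe, RingHom.coe_coe, MonoidAlgebra.lift_single,
      FreeMonoid.lift_eval_of]
    exact one_smul ℤ (q s)
  have hc : (constantCoeff (R := NCPoly S)).comp θ =
      MonoidAlgebra.mapDomainRingHom ℤ (FreeMonoid.map f) := by
    apply MonoidAlgebra.ringHom_ext'
    · exact Subsingleton.elim _ _
    · ext s : 1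
      have := hθ s
      simp only [ncVar] at this
      simp [this, hq', hφ, ncVar]
  have hΦ : (Units.map (extendSeries θ).toMonoidHom).comp magnus = magnus.comp φ := by
    ext s : 1
    apply Units.ext
    simp [magnus_of, extendSeries_X, extendSeries_C, hθ, hq]
  obtain ⟨d, p, hg, hp⟩ := hg
  refine ⟨d, extendSeries θ p, ?_, ?_⟩
  · have := congrArg Units.val (DFunLike.congr_fun hΦ g)
    simp only [MonoidHom.comp_apply] at this
    rw [← this]
    simp [hg, extendSeries_X]
  · rw [constantCoeff_extendSeries]
    have := RingHom.congr_fun hc (constantCoeff p)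
    rw [RingHom.comp_apply] at this
    rw [this]
    exact hp.map hf

end MagnusOrder

end OrderedBraid

namespace OrderedBraid

/-! ## The kernel of the exponent sum in the last generator -/

section Cover

variable {m : ℕ}

/-- The index set of the free basis `x_m ^ k x_i x_m ^ (-k)` of the kernel of the exponent sum in
the last generator of `F (m + 1)`. -/
@[ext]
structure CoverIdx (m : ℕ) where
  /-- The exponent `k`. -/
  height : ℤ
  /-- The generator `i`. -/
  strand : Fin m

/-- The permutation `(k, i) ↦ (k + a i, i)`. -/
def shiftBy (a : Fin m → ℤ) : Equiv.Perm (CoverIdx m) where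
  toFun p := ⟨p.height + a p.strand, p.strand⟩
  invFun p := ⟨p.height - a p.strand, p.strand⟩
  left_inv _ := CoverIdx.ext (by simp) rfl
  right_inv _ := CoverIdx.ext (by simp) rfl

/-- The permutation `(k, i) ↦ (k, π i)`. -/
def permBy (π : Equiv.Perm (Fin m)) : Equiv.Perm (CoverIdx m) where
  toFun p := ⟨p.height, π p.strand⟩
  invFun p := ⟨p.height, π.symm p.strand⟩
  left_inv _ := CoverIdx.ext rfl (by simp)
  right_inv _ := CoverIdx.ext rfl (by simp)

theorem permBy_mul (π ρ : Equiv.Perm (Fin m)) : permBy π * permBy ρ = permBy (π * ρ) := rfl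

theorem permBy_inv (π : Equiv.Perm (Fin m)) : (permBy π)⁻¹ = permBy π⁻¹ := rfl

theorem permBy_one : permBy (1 : Equiv.Perm (Fin m)) = 1 := rfl

theorem shiftBy_mul (a b : Fin m → ℤ) : shiftBy a * shiftBy b = shiftBy (a + b) := by
  ext p : 1
  exact CoverIdx.ext (by simp [shiftBy]; ring) rfl

theorem permBy_conj_shiftBy (π : Equiv.Perm (Fin m)) (a : Fin m → ℤ) :
    permBy π * shiftBy a * (permBy π)⁻¹ = shiftBy fun i => a (π⁻¹ i) := by
  ext p : 1
  exact CoverIdx.ext rfl (π.apply_symm_apply p.strand)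

/-- The translation action on the free group on the basis of the kernel. -/
def translation (m : ℕ) : Multiplicative ℤ →* MulAut (FreeGroup (CoverIdx m)) where
  toFun k := FreeGroup.freeGroupCongr (shiftBy fun _ => Multiplicative.toAdd k)
  map_one' := by
    ext x
    have : (shiftBy fun _ => 0 : Equiv.Perm (CoverIdx m)) = Equiv.refl _ := by
      ext p : 1
      exact CoverIdx.ext (by simp [shiftBy]) rfl
    simp [this]
  map_mul' k l := by
    have := shiftBy_mul (m := m) (fun _ => Multiplicative.toAdd k) (fun _ => Multiplicative.toAdd l)
    have h : (shiftBy fun _ => Multiplicative.toAdd (k * l) : Equiv.Perm (CoverIdx m)) =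
        (shiftBy fun _ => Multiplicative.toAdd l).trans
          (shiftBy fun _ => Multiplicative.toAdd k) := this.symm
    rw [h, ← FreeGroup.freeGroupCongr_trans]
    rfl

theorem translation_of (k : Multiplicative ℤ) (p : CoverIdx m) :
    translation m k (.of p) = .of (shiftBy (fun _ => Multiplicative.toAdd k) p) := by
  simp [translation]

/-- The semidirect product decomposition of `F (m + 1)`. -/
abbrev Cover (m : ℕ) : Type :=
  FreeGroup (CoverIdx m) ⋊[translation m] Multiplicative ℤ

/-- The homomorphism from `F (m + 1)` to its semidirect product decomposition. -/
def toCover (m : ℕ) : F (m + 1) →* Cover m :=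
  FreeGroup.lift (Fin.lastCases (SemidirectProduct.inr (.ofAdd 1))
    fun i => SemidirectProduct.inl (.of ⟨0, i⟩))

theorem toCover_last : toCover m (.of (Fin.last m)) = SemidirectProduct.inr (.ofAdd 1) := by
  simp [toCover]

theorem toCover_castSucc (i : Fin m) :
    toCover m (.of i.castSucc) = SemidirectProduct.inl (.of ⟨0, i⟩) := by
  simp [toCover]

/-- The inclusion of the kernel. -/
def ofKernel (m : ℕ) : FreeGroup (CoverIdx m) →* F (m + 1) :=
  FreeGroup.lift fun p =>
    .of (Fin.last m) ^ p.height * .of (Fin.castSucc p.strand) * (.of (Fin.last m) ^ p.height)⁻¹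

theorem ofKernel_of (p : CoverIdx m) : ofKernel m (.of p) =
    .of (Fin.last m) ^ p.height * .of (Fin.castSucc p.strand) * (.of (Fin.last m) ^ p.height)⁻¹ := by
  simp [ofKernel]

theorem toCover_ofKernel (x : FreeGroup (CoverIdx m)) :
    toCover m (ofKernel m x) = SemidirectProduct.inl x := by
  have : (toCover m).comp (ofKernel m) = SemidirectProduct.inl := by
    ext p : 1
    have hz : (SemidirectProduct.inr (Multiplicative.ofAdd (1 : ℤ)) : Cover m) ^ p.height =
        SemidirectProduct.inr (Multiplicative.ofAdd p.height) := by
      rw [← map_zpow, ← ofAdd_zsmul]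
      simp
    rw [MonoidHom.comp_apply, ofKernel_of]
    simp only [map_mul, map_inv, map_zpow, toCover_last, toCover_castSucc]
    rw [hz, ← map_inv, ← SemidirectProduct.inl_aut, translation_of]
    congr 2
    exact CoverIdx.ext (by simp [shiftBy]) rfl
  exact DFunLike.congr_fun this x

theorem toCover_injective : Function.Injective (toCover m) := by
  let inv : Cover m →* F (m + 1) :=
    SemidirectProduct.lift (ofKernel m) (zpowersHom _ (.of (Fin.last m))) (by
      intro k
      ext p : 1
      simp only [MonoidHom.comp_apply, MulEquiv.coe_toMonoidHom, translation_of, ofKernel_of,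
        MulAut.conj_apply, zpowersHom_apply]
      simp only [shiftBy, Equiv.coe_fn_mk, add_comm p.height, zpow_add]
      group)
  have : inv.comp (toCover m) = MonoidHom.id _ := by
    ext i : 1
    induction i using Fin.lastCases with
    | last => simp [inv, toCover_last]
    | cast i => simp [inv, toCover_castSucc, ofKernel_of]
  exact Function.LeftInverse.injective (g := inv) (DFunLike.congr_fun this)

theorem eq_ofKernel {g : F (m + 1)} (hg : (toCover m g).right = 1) :
    g = ofKernel m (toCover m g).left := by
  apply toCover_injective
  rw [toCover_ofKernel]
  exact SemidirectProduct.ext rfl hg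

/-- The homomorphism to the kernel given by a homomorphism to the semidirect product. -/
def leftHom {G : Type*} [Group G] (h : G →* Cover m) (hh : ∀ g, (h g).right = 1) :
    G →* FreeGroup (CoverIdx m) where
  toFun g := (h g).left
  map_one' := by simp
  map_mul' a b := by simp [hh]

/-! ### Automorphisms acting monomially on the abelianized kernel -/

theorem expSum_map {S T : Type*} (f : S → T) (x : FreeGroup S) :
    expSum (FreeGroup.map f x) =
      .ofAdd (Finsupp.mapDomain f (Multiplicative.toAdd (expSum x))) := by
  have : expSum.comp (FreeGroup.map f) =
      (AddMonoidHom.toMultiplicative (Finsupp.mapDomain.addMonoidHom f)).comp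
        (expSum (S := S)) := by
    ext s : 1
    simp [expSum_of]
  exact DFunLike.congr_fun this x

/-- `ψ` preserves the exponent sum in the last generator, and permutes the basis of the kernel
according to `f` up to commutators of the kernel. -/
structure IsMonomial (ψ : MulAut (F (m + 1))) (f : Equiv.Perm (CoverIdx m)) : Prop where
  right : ∀ g, (toCover m (ψ g)).right = (toCover m g).right
  left : ∀ g, (toCover m g).right = 1 → expSum (toCover m (ψ g)).left =
    .ofAdd (Finsupp.mapDomain f (Multiplicative.toAdd (expSum (toCover m g).left)))

theorem IsMonomial.one : IsMonomial (1 : MulAut (F (m + 1))) 1 where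
  right _ := rfl
  left g _ := by simp [Equiv.Perm.coe_one, Finsupp.mapDomain_id]

theorem IsMonomial.mul {ψ ψ' : MulAut (F (m + 1))} {f f' : Equiv.Perm (CoverIdx m)}
    (h : IsMonomial ψ f) (h' : IsMonomial ψ' f') : IsMonomial (ψ * ψ') (f * f') where
  right g := by rw [MulAut.mul_apply, h.right, h'.right]
  left g hg := by
    rw [MulAut.mul_apply, h.left _ (by rw [h'.right, hg]), h'.left g hg, toAdd_ofAdd,
      Equiv.Perm.coe_mul, Finsupp.mapDomain_comp]

theorem IsMonomial.inv {ψ : MulAut (F (m + 1))} {f : Equiv.Perm (CoverIdx m)}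
    (h : IsMonomial ψ f) : IsMonomial ψ⁻¹ f⁻¹ where
  right g := by rw [← h.right, MulAut.apply_inv_self]
  left g hg := by
    have h1 : (toCover m (ψ⁻¹ g)).right = 1 := by
      rw [← h.right, MulAut.apply_inv_self, hg]
    have h2 := h.left _ h1
    rw [MulAut.apply_inv_self] at h2
    rw [h2, toAdd_ofAdd, ← Finsupp.mapDomain_comp, ← Equiv.Perm.coe_mul, inv_mul_cancel,
      Equiv.Perm.coe_one, Finsupp.mapDomain_id, ofAdd_toAdd]

/-- The basis element of height `k` is the conjugate of `x_i` by the `k`-th power of the last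
generator. Its image is conjugated by an element with the same exponent sum `k`, which in the
abelianized kernel is a shift by `k`; `hf` says that `f` is compatible with this. -/
theorem IsMonomial.of_generators {ψ : MulAut (F (m + 1))} {f : Equiv.Perm (CoverIdx m)}
    (hlast : (toCover m (ψ (.of (Fin.last m)))).right = .ofAdd 1)
    (hright : ∀ i, (toCover m (ψ (.of (Fin.castSucc i)))).right = 1)
    (hleft : ∀ i, expSum (toCover m (ψ (.of (Fin.castSucc i)))).left =
      .ofAdd (Finsupp.single (f ⟨0, i⟩) 1))
    (hf : ∀ (k : ℤ) (i : Fin m),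
      f ⟨k, i⟩ = shiftBy (fun _ => k) (f ⟨0, i⟩)) :
    IsMonomial ψ f := by
  have hr : ∀ g, (toCover m (ψ g)).right = (toCover m g).right := by
    intro g
    have : (SemidirectProduct.rightHom.comp (toCover m)).comp ψ.toMonoidHom =
        SemidirectProduct.rightHom.comp (toCover m) := by
      ext i : 1
      induction i using Fin.lastCases with
      | last => simpa [toCover_last] using hlast
      | cast i => simpa [toCover_castSucc] using hright i
    exact DFunLike.congr_fun this g
  refine ⟨hr, fun g hg => ?_⟩
  have hk : ∀ x, (((toCover m).comp ψ.toMonoidHom).comp (ofKernel m) x).right = 1 := by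
    intro x
    simp [hr, toCover_ofKernel]
  have h : expSum.comp (leftHom _ hk) =
      (AddMonoidHom.toMultiplicative (Finsupp.mapDomain.addMonoidHom f)).comp expSum := by
    ext p : 1
    obtain ⟨k, i⟩ := p
    set u : Cover m := toCover m (ψ (.of (Fin.last m) ^ k))
    set w : Cover m := toCover m (ψ (.of (Fin.castSucc i)))
    have hu : u.right = .ofAdd k := by
      rw [hr, map_zpow, toCover_last, ← map_zpow, SemidirectProduct.right_inr, ← ofAdd_zsmul]
      simp
    have hL : leftHom _ hk (.of ⟨k, i⟩) =
        u.left * translation m (.ofAdd k) w.left * u.left⁻¹ := by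
      change (toCover m (ψ (ofKernel m _))).left = _
      rw [ofKernel_of, map_mul, map_mul, map_mul, map_mul, map_inv, map_inv]
      change (u * w * u⁻¹).left = _
      simp [hu, w, hright]
    have hT : translation m (.ofAdd k) w.left = FreeGroup.map (shiftBy fun _ => k) w.left := rfl
    rw [MonoidHom.comp_apply, hL, map_mul, map_mul, map_inv, mul_inv_cancel_comm, hT, expSum_map,
      hleft]
    simp [expSum_of, ← hf]
  have h1 := DFunLike.congr_fun h (toCover m g).left
  have h2 : leftHom _ hk (toCover m g).left = (toCover m (ψ g)).left := by
    change (toCover m (ψ (ofKernel m _))).left = _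
    rw [← eq_ofKernel hg]
  rw [MonoidHom.comp_apply, h2] at h1
  exact h1

theorem IsMonomial.isOrderPreservingAut [LinearOrder (CoverIdx m)] {ψ : MulAut (F (m + 1))}
    {f : Equiv.Perm (CoverIdx m)} (h : IsMonomial ψ f) (hf : StrictMono f)
    (hs : ∀ k : ℤ, StrictMono (shiftBy fun _ => k : Equiv.Perm (CoverIdx m))) :
    IsOrderPreservingAut ψ := by
  -- Monotonicity of the translations makes the Magnus cone of the kernel invariant under the cyclic
  -- factor.
  have hP : IsPosCone (semidirectPos (α := translation m) MagnusPos) := by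
    refine isPosCone_magnusPos.semidirect fun k g hg => ?_
    refine hg.map (φ := (translation m k).toMonoidHom) (hs (Multiplicative.toAdd k)) fun s => ?_
    rw [MulEquiv.coe_toMonoidHom, translation_of, expSum_of]
  refine (hP.comap _ toCover_injective).isOrderPreservingAut ψ fun g hg => ?_
  rcases hg with hg | ⟨hg, hg'⟩
  · left
    rwa [h.right]
  · right
    refine ⟨by rw [h.right, hg], ?_⟩
    have hk : ∀ x, (((toCover m).comp ψ.toMonoidHom).comp (ofKernel m) x).right = 1 := by
      intro x
      simp [h.right, toCover_ofKernel]
    have h2 : leftHom _ hk (toCover m g).left = (toCover m (ψ g)).left := by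
      change (toCover m (ψ (ofKernel m _))).left = _
      rw [← eq_ofKernel hg]
    rw [← h2]
    refine hg'.map hf fun s => ?_
    change expSum (toCover m (ψ (ofKernel m _))).left = _
    rw [h.left _ (by simp [toCover_ofKernel])]
    simp [toCover_ofKernel, expSum_of]

end Cover

end OrderedBraid

namespace OrderedBraid

/-! ## Braids acting monomially -/

section Braids

variable {n m : ℕ}

theorem artinAut_mul (a b : BraidGroup n) : artinAut (a * b) = artinAut b * artinAut a := by
  simp [artinAut]

theorem artinAut_one : artinAut (1 : BraidGroup n) = 1 := by
  simp [artinAut]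

theorem artinAut_inv (a : BraidGroup n) : artinAut a⁻¹ = (artinAut a)⁻¹ := by
  simp [artinAut]

theorem artinAut_sigma (i : Fin (n - 1)) : artinAut (sigma i) = artinGen i := by
  simp [artinAut, artin, sigma]

theorem isMonomial_sigma (i : Fin (m + 1 - 1)) (a b : Fin m) (ha : lo i = a.castSucc)
    (hb : hi i = b.castSucc) :
    IsMonomial (artinAut (sigma i : BraidGroup (m + 1))) (permBy (Equiv.swap a b)) := by
  rw [artinAut_sigma]
  have hlast : artinGen i (.of (Fin.last m)) = .of (Fin.last m) := by
    rw [artinGen_apply, artinHom_of_ne i]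
    · rw [ha]; exact (Fin.castSucc_ne_last a).symm
    · rw [hb]; exact (Fin.castSucc_ne_last b).symm
  have hA : artinGen i (.of a.castSucc) =
      .of a.castSucc * .of b.castSucc * (.of a.castSucc)⁻¹ := by
    rw [artinGen_apply, ← ha, ← hb, artinHom_lo]
  have hB : artinGen i (.of b.castSucc) = .of a.castSucc := by
    rw [artinGen_apply, ← ha, ← hb, artinHom_hi]
  have hC : ∀ c, c ≠ a → c ≠ b → artinGen i (.of c.castSucc) = .of c.castSucc := by
    intro c h1 h2
    rw [artinGen_apply, artinHom_of_ne i]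
    · rw [ha]; simpa using h1
    · rw [hb]; simpa using h2
  refine IsMonomial.of_generators ?_ ?_ ?_ ?_
  · rw [hlast, toCover_last, SemidirectProduct.right_inr]
  · intro c
    by_cases h1 : c = a
    · subst h1; simp [hA, toCover_castSucc]
    by_cases h2 : c = b
    · subst h2; simp [hB, toCover_castSucc]
    · simp [hC c h1 h2, toCover_castSucc]
  · intro c
    by_cases h1 : c = a
    · subst h1; simp [hA, toCover_castSucc, expSum_of, permBy]
    by_cases h2 : c = b
    · subst h2; simp [hB, toCover_castSucc, expSum_of, permBy]
    · simp [hC c h1 h2, toCover_castSucc, expSum_of, permBy, Equiv.swap_apply_of_ne_of_ne h1 h2]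
  · intro k c
    exact CoverIdx.ext (by simp [permBy, shiftBy]) rfl

theorem exists_isMonomial_braidIncl (β : BraidGroup m) :
    ∃ π, IsMonomial (artinAut (braidIncl (Nat.le_succ m) β)) (permBy π) := by
  have hβ : β ∈ Subgroup.closure (Set.range (PresentedGroup.of (rels := braidRels m))) := by
    rw [PresentedGroup.closure_range_of]; trivial
  induction hβ using Subgroup.closure_induction with
  | mem x hx =>
    obtain ⟨i, rfl⟩ := hx
    refine ⟨Equiv.swap (lo i) (hi i), ?_⟩
    have : braidIncl (Nat.le_succ m) (PresentedGroup.of i) =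
        (sigma (Fin.castLE (by omega) i) : BraidGroup (m + 1)) := by
      simp [braidIncl]
    rw [this]
    exact isMonomial_sigma _ _ _ rfl rfl
  | one => exact ⟨1, by simpa [artinAut_one, permBy_one] using IsMonomial.one⟩
  | mul x y _ _ hx hy =>
    obtain ⟨π, hx⟩ := hx
    obtain ⟨ρ, hy⟩ := hy
    exact ⟨ρ * π, by simpa [artinAut_mul, permBy_mul] using hy.mul hx⟩
  | inv x _ hx =>
    obtain ⟨π, hx⟩ := hx
    exact ⟨π⁻¹, by simpa [artinAut_inv, permBy_inv] using hx.inv⟩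

/-- With `z` the last generator, `x_a` is sent to `x_a * (z * x_a * z⁻¹) * x_a⁻¹`, a conjugate
within the kernel of the basis element of height `1`. -/
theorem isMonomial_sigma_sq (i : Fin (m + 1 - 1)) (a : Fin m) (ha : lo i = a.castSucc)
    (hb : hi i = Fin.last m) :
    IsMonomial (artinAut (sigma i ^ 2 : BraidGroup (m + 1))) (shiftBy (Pi.single a 1)) := by
  have hlast : artinAut (sigma i ^ 2) (.of (Fin.last m)) =
      .of a.castSucc * .of (Fin.last m) * (.of a.castSucc)⁻¹ := by
    rw [pow_two, artinAut_mul, artinAut_sigma, MulAut.mul_apply, artinGen_apply, artinGen_apply,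
      ← ha, ← hb, artinHom_hi, artinHom_lo]
  have hA : artinAut (sigma i ^ 2) (.of a.castSucc) =
      .of a.castSucc * .of (Fin.last m) * .of a.castSucc * (.of (Fin.last m))⁻¹ *
        (.of a.castSucc)⁻¹ := by
    rw [pow_two, artinAut_mul, artinAut_sigma, MulAut.mul_apply, artinGen_apply, artinGen_apply,
      ← ha, ← hb, artinHom_lo, map_mul, map_mul, map_inv, artinHom_lo, artinHom_hi]
    group
  have hC : ∀ c, c ≠ a → artinAut (sigma i ^ 2) (.of c.castSucc) = .of c.castSucc := by
    intro c h1
    have h : artinHom i (.of c.castSucc) = .of c.castSucc := by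
      rw [artinHom_of_ne i]
      · rw [ha]; simpa using h1
      · rw [hb]; exact Fin.castSucc_ne_last c
    rw [pow_two, artinAut_mul, artinAut_sigma, MulAut.mul_apply, artinGen_apply, artinGen_apply,
      h, h]
  refine IsMonomial.of_generators ?_ ?_ ?_ ?_
  · simp [hlast, toCover_last, toCover_castSucc]
  · intro c
    by_cases h1 : c = a
    · subst h1; simp [hA, toCover_last, toCover_castSucc]
    · simp [hC c h1, toCover_castSucc]
  · intro c
    by_cases h1 : c = a
    · subst h1
      simp [hA, toCover_last, toCover_castSucc, expSum_of, translation_of, shiftBy]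
    · simp [hC c h1, toCover_castSucc, expSum_of, shiftBy, h1]
  · intro k c
    exact CoverIdx.ext (by simp [shiftBy, add_comm]) rfl

/-! ### The action of the pure braids `A_{i,n}` -/

/-- The generators of the braid group, continued by `1`. -/
def sigmaNat (n k : ℕ) : BraidGroup n := if h : k < n - 1 then sigma ⟨k, h⟩ else 1

theorem sigmaNat_of_lt {k : ℕ} (h : k < n - 1) : sigmaNat n k = sigma ⟨k, h⟩ := dif_pos h

theorem sigmaNat_commute {k l : ℕ} (h : k + 1 < l) : Commute (sigmaNat n k) (sigmaNat n l) := by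
  unfold sigmaNat
  split_ifs with h1 h2
  · exact sigma_comm _ _ (Or.inl h)
  all_goals simp

theorem sigmaNat_braid {k : ℕ} (h : k + 1 < n - 1) :
    sigmaNat n k * sigmaNat n (k + 1) * sigmaNat n k =
      sigmaNat n (k + 1) * sigmaNat n k * sigmaNat n (k + 1) := by
  rw [sigmaNat_of_lt h, sigmaNat_of_lt (by omega)]
  exact sigma_braid _ _ rfl

/-- This lets `A_{a,n}` be rewritten as the conjugate `σ_a⁻¹ A_{a+1,n} σ_a`, on which
`isMonomial_descending` inducts. -/
theorem sigmaNat_conj_sq {k : ℕ} (h : k + 1 < n - 1) :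
    sigmaNat n (k + 1) * sigmaNat n k ^ 2 * (sigmaNat n (k + 1))⁻¹ =
      (sigmaNat n k)⁻¹ * sigmaNat n (k + 1) ^ 2 * sigmaNat n k := by
  have hb := sigmaNat_braid h
  set s := sigmaNat n k
  set t := sigmaNat n (k + 1)
  rw [mul_inv_eq_iff_eq_mul, mul_assoc, mul_assoc, eq_inv_mul_iff_mul_eq]
  calc s * (t * s ^ 2) = s * t * s * s := by simp only [pow_two, mul_assoc]
    _ = t * s * t * s := by rw [hb]
    _ = t * (s * t * s) := by simp only [mul_assoc]
    _ = t ^ 2 * (s * t) := by rw [hb, pow_two]; simp only [mul_assoc]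

/-- The product `σ_{j-1} σ_{j-2} ⋯` of `d` factors. -/
def descending (n j d : ℕ) : BraidGroup n :=
  ((List.range d).map fun t => sigmaNat n (j - 1 - t)).prod

theorem descending_succ (j d : ℕ) :
    descending n j (d + 1) = descending n j d * sigmaNat n (j - 1 - d) := by
  simp [descending, List.range_succ]

theorem descending_commute {j d k : ℕ} (h : k + 1 + d < j) :
    Commute (sigmaNat n k) (descending n j d) := by
  induction d with
  | zero => simp [descending]
  | succ d ih =>
    rw [descending_succ]
    exact (ih (by omega)).mul_right (sigmaNat_commute (by omega))

theorem pureGen_eq (i j : Fin n) (hij : i < j) :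
    pureGen i j hij = descending n j ((j : ℕ) - 1 - i) * sigmaNat n i ^ 2 *
      (descending n j ((j : ℕ) - 1 - i))⁻¹ := by
  have h : (List.ofFn fun t : Fin ((j : ℕ) - 1 - (i : ℕ)) =>
      (sigma ⟨(j : ℕ) - 1 - (t : ℕ), by omega⟩ : BraidGroup n)).prod =
      descending n j ((j : ℕ) - 1 - i) := by
    rw [descending]
    congr 1
    apply List.ext_getElem (by simp)
    intro t h1 h2
    simp only [List.length_ofFn] at h1
    simp [sigmaNat_of_lt (n := n) (k := (j : ℕ) - 1 - t) (by omega)]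
  rw [pureGen, h, sigmaNat_of_lt (by omega)]

theorem isMonomial_descending (d : ℕ) (a : Fin m) (ha : m - 1 - d = a) (hd : d < m) :
    IsMonomial (artinAut (descending (m + 1) m d * sigmaNat (m + 1) a ^ 2 *
      (descending (m + 1) m d)⁻¹)) (shiftBy (Pi.single a 1)) := by
  induction d generalizing a with
  | zero =>
    rw [sigmaNat_of_lt (by omega)]
    simpa [descending] using isMonomial_sigma_sq ⟨a, by omega⟩ a rfl
      (Fin.ext (by simp [hi]; omega))
  | succ d ih =>
    have hb : (a : ℕ) + 1 < m := by omega
    have ih := ih ⟨a + 1, hb⟩ (by simp; omega) (by omega)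
    have hs : IsMonomial (artinAut (sigmaNat (m + 1) a))
        (permBy (Equiv.swap a ⟨a + 1, hb⟩)) := by
      rw [sigmaNat_of_lt (by omega)]
      exact isMonomial_sigma _ _ _ rfl rfl
    have hc := descending_commute (n := m + 1) (j := m) (d := d) (k := a) (by omega)
    have key : descending (m + 1) m (d + 1) * sigmaNat (m + 1) a ^ 2 *
        (descending (m + 1) m (d + 1))⁻¹ = (sigmaNat (m + 1) a)⁻¹ *
          (descending (m + 1) m d * sigmaNat (m + 1) (a + 1) ^ 2 *
            (descending (m + 1) m d)⁻¹) * sigmaNat (m + 1) a := by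
      have h1 : m - 1 - d = a + 1 := by omega
      have h2 := sigmaNat_conj_sq (n := m + 1) (k := a) (by omega)
      rw [descending_succ, h1]
      set c := descending (m + 1) m d
      set s := sigmaNat (m + 1) a
      set t := sigmaNat (m + 1) (a + 1)
      calc c * t * s ^ 2 * (c * t)⁻¹ = c * (t * s ^ 2 * t⁻¹) * c⁻¹ := by group
        _ = (c * s⁻¹) * t ^ 2 * (s * c⁻¹) := by rw [h2]; simp only [mul_assoc]
        _ = (s⁻¹ * c) * t ^ 2 * (c⁻¹ * s) := by
          rw [hc.inv_left.eq, hc.inv_right.eq]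
        _ = s⁻¹ * (c * t ^ 2 * c⁻¹) * s := by simp only [mul_assoc]
    rw [key, artinAut_mul, artinAut_mul, artinAut_inv, ← mul_assoc]
    -- Conjugating the shift at `a + 1` by the transposition of `a` and `a + 1` gives the shift at
    -- `a`.
    have := (hs.mul ih).mul hs.inv
    rw [permBy_conj_shiftBy] at this
    convert this using 2
    ext i
    simp only [Equiv.swap_inv, Pi.single_apply]
    congr 1
    rw [Equiv.swap_apply_eq_iff, Equiv.swap_apply_right]

theorem isMonomial_pureGen_last (a : Fin m) (h : a.castSucc < Fin.last m) :
    IsMonomial (artinAut (pureGen a.castSucc (Fin.last m) h)) (shiftBy (Pi.single a 1)) := by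
  rw [pureGen_eq]
  exact isMonomial_descending (m - 1 - a) a (by omega) (by omega)

/-- The shifts commute and add up, so one factor for each element of `T` suffices. `T` must be
nonempty because a subsemigroup need not contain the empty product. -/
theorem exists_isMonomial_shiftBy (T : Finset (Fin m)) (hT : T.Nonempty) :
    ∃ α ∈ Subsemigroup.closure {a : BraidGroup (m + 1) | ∃ (i : Fin (m + 1))
        (hi : i < Fin.last m), a = pureGen i (Fin.last m) hi},
      IsMonomial (artinAut α) (shiftBy fun i => if i ∈ T then 1 else 0) := by
  induction hT using Finset.Nonempty.cons_induction with
  | singleton a =>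
    refine ⟨_, Subsemigroup.subset_closure ⟨a.castSucc, Fin.castSucc_lt_last a, rfl⟩, ?_⟩
    convert isMonomial_pureGen_last a (Fin.castSucc_lt_last a) using 2
    ext i
    simp [Pi.single_apply]
  | cons a T ha _ ih =>
    obtain ⟨α, hα, h⟩ := ih
    refine ⟨_, Subsemigroup.mul_mem _
      (Subsemigroup.subset_closure ⟨a.castSucc, Fin.castSucc_lt_last a, rfl⟩) hα, ?_⟩
    rw [artinAut_mul]
    convert h.mul (isMonomial_pureGen_last a (Fin.castSucc_lt_last a)) using 1
    rw [shiftBy_mul]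
    congr 1
    ext i
    by_cases hi : i = a
    · subst hi; simp [ha]
    · simp [hi]

end Braids

/-! ## An invariant ordering of the basis of the kernel -/

section Order

variable {m : ℕ}

open Function

/-- For each permutation `π` there is a choice of representatives of the cycles and an ordering
for which all translations, and `π` followed by a shift at the representatives, are monotone. -/
theorem exists_linearOrder_coverIdx [NeZero m] (π : Equiv.Perm (Fin m)) :
    ∃ (T : Finset (Fin m)) (_ : T.Nonempty) (_ : LinearOrder (CoverIdx m)),
      StrictMono ((shiftBy fun i => if i ∈ T then 1 else 0 : Equiv.Perm (CoverIdx m)) *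
        permBy π : Equiv.Perm (CoverIdx m)) ∧
      ∀ k : ℤ, StrictMono (shiftBy fun _ => k : Equiv.Perm (CoverIdx m)) := by
  classical
  let r : Fin m → Fin m := fun i =>
    (Quotient.mk (Equiv.Perm.SameCycle.setoid π) i).out
  have hr : ∀ i, π.SameCycle (r i) i := fun i =>
    Quotient.mk_out (s := Equiv.Perm.SameCycle.setoid π) i
  have hrc : ∀ i j, π.SameCycle i j → r i = r j := fun i j h =>
    congrArg Quotient.out (Quotient.sound (s := Equiv.Perm.SameCycle.setoid π) h)
  have hrr : ∀ i, r (r i) = r i := fun i => hrc _ _ (hr i)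
  have hrπ : ∀ i, r (π i) = r i := fun i =>
    hrc _ _ (Equiv.Perm.sameCycle_apply_left.2 (Equiv.Perm.SameCycle.refl _ _))
  have hper : ∀ i, 0 < minimalPeriod π i := fun i =>
    minimalPeriod_pos_of_mem_periodicPts (π.injective.mem_periodicPts i)
  have hp : ∀ i, ∃ p < minimalPeriod π (r i), π^[p] (r i) = i := fun i => by
    obtain ⟨p, hp⟩ := (hr i).exists_nat_pow_eq
    refine ⟨p % minimalPeriod π (r i), Nat.mod_lt _ (hper _), ?_⟩
    rw [iterate_mod_minimalPeriod_eq, Equiv.Perm.iterate_eq_pow, hp]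
  choose p hpl hp using hp
  -- `r i` represents the cycle of `i` and `p i` is the position of `i` counted from `r i`. The
  -- height counts full turns around the cycle, so the second coordinate unrolls all pairs over one
  -- cycle into a line.
  let key : CoverIdx m → Fin m ×ₗ ℤ := fun x =>
    toLex (r x.strand, x.height * minimalPeriod π (r x.strand) + p x.strand)
  have hinj : Injective key := by
    rintro ⟨k, i⟩ ⟨l, j⟩ h
    have h1 : r i = r j := congrArg (fun x => (ofLex x).1) h
    have h2 : k * minimalPeriod π (r i) + p i = l * minimalPeriod π (r j) + p j :=
      congrArg (fun x => (ofLex x).2) h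
    have hi := hpl i
    have hj := hpl j
    rw [← h1] at h2 hj
    -- The position is the remainder, and the height the quotient, of the second coordinate modulo
    -- the cycle length.
    have hpij : p i = p j := by
      have := congrArg (· % (minimalPeriod π (r i) : ℤ)) h2
      simp only [Int.mul_add_emod_self_right] at this
      rw [Int.emod_eq_of_lt (by omega) (by omega), Int.emod_eq_of_lt (by omega) (by omega)] at this
      omega
    have hij : i = j := by rw [← hp i, ← hp j, hpij, h1]
    subst hij
    have h0 := hper (r i)
    have : k = l := by
      have h3 : k * minimalPeriod π (r i) = l * minimalPeriod π (r i) := by omega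
      exact mul_right_cancel₀ (by omega) h3
    rw [this]
  let I : LinearOrder (CoverIdx m) := LinearOrder.lift' key hinj
  have hlt : ∀ x y : CoverIdx m, x < y ↔ key x < key y := fun x y => Iff.rfl
  -- Translating each line by an amount that depends only on its cycle preserves the lexicographic
  -- order.
  have hmono : ∀ (f : CoverIdx m → CoverIdx m) (c : Fin m → ℤ),
      (∀ x, key (f x) = toLex ((ofLex (key x)).1, (ofLex (key x)).2 + c (ofLex (key x)).1)) →
      StrictMono f := by
    intro f c hf x y hxy
    rw [hlt] at hxy ⊢
    rw [hf, hf]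
    rw [Prod.Lex.lt_iff] at hxy ⊢
    rcases hxy with hxy | ⟨h1, h2⟩
    · exact Or.inl hxy
    · refine Or.inr ⟨h1, ?_⟩
      simp only [ofLex_toLex]
      rw [h1]
      exact add_lt_add_left h2 _
  -- With `T` the set of representatives, the composite advances every line by `1`, and translation
  -- of heights by `k` advances it by `k` times the cycle length.
  refine ⟨Finset.univ.image r, ⟨r 0, by simp⟩, I, hmono _ (fun _ => 1) ?_,
    fun k => hmono _ (fun i => k * minimalPeriod π i) ?_⟩
  · rintro ⟨k, i⟩
    have hmem : π i ∈ Finset.univ.image r ↔ π i = r i := by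
      constructor
      · intro h
        obtain ⟨j, -, hj⟩ := Finset.mem_image.1 h
        rw [← hrπ i, ← hj, hrr]
      · intro h
        exact Finset.mem_image.2 ⟨i, by simp, h.symm⟩
    have hnext : π^[p i + 1] (r i) = π i := by
      rw [iterate_succ_apply', hp]
    have hpi := hpl i
    have hpπ := hpl (π i)
    have hpπ' := hp (π i)
    rw [hrπ] at hpπ hpπ'
    have h0 := hper (r i)
    simp only [Equiv.Perm.mul_apply, permBy, shiftBy, Equiv.coe_fn_mk, key, ofLex_toLex, hrπ, hmem]
    congr 2
    -- When `π` returns to the representative, the position drops from the cycle length minus one to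
    -- `0`, and the unit of height added on `T` makes up for it. Otherwise the position itself grows
    -- by one.
    by_cases h : π i = r i
    · rw [if_pos h]
      have hd : minimalPeriod π (r i) ∣ p i + 1 :=
        IsPeriodicPt.minimalPeriod_dvd (by rw [IsPeriodicPt, IsFixedPt, hnext, h])
      have hd' : minimalPeriod π (r i) = p i + 1 :=
        le_antisymm (Nat.le_of_dvd (by omega) hd) hpi
      have hz : p (π i) = 0 := by
        rw [← iterate_eq_iterate_iff_of_lt_minimalPeriod hpπ h0, hpπ', h, iterate_zero, id]
      rw [hz, add_mul, one_mul]
      push_cast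
      have : (minimalPeriod π (r i) : ℤ) = p i + 1 := by exact_mod_cast hd'
      omega
    · rw [if_neg h]
      have hlt' : p i + 1 < minimalPeriod π (r i) := by
        refine lt_of_le_of_ne hpi fun he => h ?_
        rw [← hnext]
        exact he ▸ iterate_minimalPeriod
      have hz : p (π i) = p i + 1 := by
        rw [← iterate_eq_iterate_iff_of_lt_minimalPeriod hpπ hlt', hpπ', hnext]
      rw [hz]
      push_cast
      ring
  · rintro ⟨l, i⟩
    simp only [shiftBy, Equiv.coe_fn_mk, key, ofLex_toLex]
    congr 2
    ring

end Order

end OrderedBraid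

/-! ### Assembly of the theorem -/

theorem propositionP (n : ℕ) (hn : 3 ≤ n) (β : OrderedBraid.BraidGroup (n - 1)) :
    ∃ α ∈ Subsemigroup.closure
        {a : OrderedBraid.BraidGroup n | ∃ (i : Fin n) (hi : i < (⟨n - 1, by omega⟩ : Fin n)),
          a = OrderedBraid.pureGen i ⟨n - 1, by omega⟩ hi},
      OrderedBraid.IsOrderPreserving (OrderedBraid.braidIncl (Nat.sub_le n 1) β * α) := by
  obtain ⟨m, rfl⟩ : ∃ m, n = m + 1 := ⟨n - 1, by omega⟩
  have : NeZero m := ⟨by omega⟩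
  obtain ⟨π, hβ⟩ := OrderedBraid.exists_isMonomial_braidIncl β
  obtain ⟨T, hT, I, hf, hs⟩ := OrderedBraid.exists_linearOrder_coverIdx (m := m) π
  obtain ⟨α, hα, h⟩ := OrderedBraid.exists_isMonomial_shiftBy T hT
  refine ⟨α, hα, ?_⟩
  -- The action is on the right, so the automorphism of `β` is applied before that of `α`: first the
  -- permutation `π`, then the shift on `T`, as in `hf`.
  rw [OrderedBraid.IsOrderPreserving, OrderedBraid.artinAut_mul]
  exact (h.mul hβ).isOrderPreservingAut hf hs
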